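/- Let $n\ge 2$, let $\lambda_1>\lambda_2>\dots>\lambda_n>0$, and let $X_0$ be a real $n\times n$ tridiagonal Hessenberg matrix (ones on the superdiagonal, arbitrary real diagonal entries, subdiagonal entries $b_1(0),\dots,b_{n-1}(0)$, zeros elsewhere) with eigenvalues $\lambda_1,\dots,\lambda_n$ and with $b_i(0)\neq 0$ for all $i$. Let $X(t)$, $t\in\mathbb{Z}$, be the solution of the discrete-time Toda lattice (Symes's dynamics) with $X(0)=X_0$: for each $t$ one has $X(t)=L(t)R(t)$ and $X(t+1)=R(t)L(t)$ with $L(t)$ lower unipotent and $R(t)$ upper triangular. Let $b_k(t)=X(t)_{k+1,k}$ denote the subdiagonal entries. Then for every $1\le k\le n-1$, \[ \lim_{t\to+\infty} b_{n-k}(t)\,b_k(-t)\left(\frac{\lambda_{n-k}}{\lambda_{n-k+1}}\right)^{2t} =\frac{\prod_{1\le j<k+1}(\lambda_{n-k}-\lambda_{n-j+1})^2\ \prod_{k<j\le n}(\lambda_{n-k+1}-\lambda_{n-j+1})^2} {\prod_{k+1<j\le n}(\lambda_{n-k}-\lambda_{n-j+1})^2\ \prod_{1\le j<k}(\lambda_{n-k+1}-\lambda_{n-j+1})^2},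 \] where $t$ runs through the integers. The same holds for the solution continued through singular times. For all integers $t$ of sufficiently large absolute value, $X_0^t$ has a factorization $X_0^t=LR$ with $L$ lower unipotent and $R$ upper triangular; and if $X(t)=L^{-1}X_0L$ at every integer $t$ at which $X_0^t$ has such a factorization (with $X(t)$ arbitrary at the other times), then the limit above holds for the subdiagonal entries of $X(t)$. -/

import Mathlib

open Filter Topology

/-- Tridiagonal Hessenberg matrices: ones on the superdiagonal, arbitrary diagonal and subdiagonal,
zeros elsewhere. -/
structure IsTridiagonalHessenberg {n : ℕ} (X : Matrix (Fin n) (Fin n) ℝ) : Prop where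
  superdiag : ∀ i j : Fin n, (j : ℕ) = i + 1 → X i j = 1
  above : ∀ i j : Fin n, (i : ℕ) + 1 < j → X i j = 0
  below : ∀ i j : Fin n, (j : ℕ) + 1 < i → X i j = 0

/-- The `k`-th subdiagonal entry `b_k` of `X`, in the one-based numbering `k = 1, …, n - 1`: the
entry in row `k + 1` and column `k`. (Outside this range the value is `0` and is not used.) -/
def subdiagEntry {n : ℕ} (X : Matrix (Fin n) (Fin n) ℝ) (k : ℕ) : ℝ :=
  if h : 1 ≤ k ∧ k < n then X ⟨k, h.2⟩ ⟨k - 1, lt_of_le_of_lt (Nat.sub_le k 1) h.2⟩ else 0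

/-- `M = L R` with `L` lower unipotent and `R` upper triangular. -/
structure IsLUFactorization {n : ℕ} (M L R : Matrix (Fin n) (Fin n) ℝ) : Prop where
  lower : ∀ i j : Fin n, i < j → L i j = 0
  unipotent : ∀ i : Fin n, L i i = 1
  upper : ∀ i j : Fin n, j < i → R i j = 0
  eq_mul : M = L * R

/-- One step of Symes's dynamics: factor `Y = L R` and permute the factors, `Z = R L`. -/
def IsSymesStep {n : ℕ} (Y Z : Matrix (Fin n) (Fin n) ℝ) : Prop :=
  ∃ L R : Matrix (Fin n) (Fin n) ℝ, IsLUFactorization Y L R ∧ Z = R * L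

/-- A solution of Symes's discrete-time dynamics through `X₀`, defined at all integer times. -/
structure IsSymesOrbit {n : ℕ} (X₀ : Matrix (Fin n) (Fin n) ℝ)
    (X : ℤ → Matrix (Fin n) (Fin n) ℝ) : Prop where
  initial : X 0 = X₀
  step : ∀ t : ℤ, IsSymesStep (X t) (X (t + 1))

/-- The solution through `X₀` continued through singularities: at each integer time `t` at which
`X₀ ^ t = L R` can be factored, `X(t) = L⁻¹ X₀ L`; at the other times (the singular ones) the value
is arbitrary. -/
def IsContinuedOrbit {n : ℕ} (X₀ : Matrix (Fin n) (Fin n) ℝ)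
    (X : ℤ → Matrix (Fin n) (Fin n) ℝ) : Prop :=
  ∀ (t : ℤ) (L R : Matrix (Fin n) (Fin n) ℝ),
    IsLUFactorization (X₀ ^ t) L R → X t = L⁻¹ * X₀ * L

/-- The limit relation for the subdiagonal entries `b_{n-k}(t)` and `b_k(-t)` as `t → +∞` through
the integers, for eigenvalues `lam 1, …, lam n`. -/
def PhaseShiftLimit (n : ℕ) (lam : ℕ → ℝ) (X : ℤ → Matrix (Fin n) (Fin n) ℝ) (k : ℕ) : Prop :=
  Tendsto
    (fun t : ℤ => subdiagEntry (X t) (n - k) * subdiagEntry (X (-t)) k *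
      (lam (n - k) / lam (n - k + 1)) ^ (2 * t))
    atTop
    (𝓝 (((∏ j ∈ Finset.Ico 1 (k + 1), (lam (n - k) - lam (n - j + 1)) ^ 2) *
          ∏ j ∈ Finset.Ioc k n, (lam (n - k + 1) - lam (n - j + 1)) ^ 2) /
        ((∏ j ∈ Finset.Ioc (k + 1) n, (lam (n - k) - lam (n - j + 1)) ^ 2) *
          ∏ j ∈ Finset.Ico 1 k, (lam (n - k + 1) - lam (n - j + 1)) ^ 2)))

open Matrix

/-! If `X₀ ^ t = L R`, then `X₀` commutes with `L R`, so `X(t) = L⁻¹ X₀ L = R X₀ R⁻¹`. Hence each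
subdiagonal entry is its initial value times a ratio of consecutive diagonal entries of `R`, and
these are ratios of leading minors of `X₀ ^ t` (`conj_subdiag_mul`,
`IsLUFactorization.leadingMinor_succ`).

Write `X₀ = P D P⁻¹`, where the columns of `P` are values of monic polynomials of degrees 0, 1, ….
If the powers of the eigenvalues are ordered decreasingly along the limit, the `k`-th minor grows
like `(d 0 ⋯ d (k - 1)) ^ t`, with constant the product of the `k`-th minors of `P` and `P⁻¹`
(`tendsto_leadingMinor_zpow`). The first is a Vandermonde determinant. A diagonal matrix symmetrizes
`X₀`, so `P⁻¹` is `Pᵀ` up to diagonal factors, and its minors are Vandermonde determinants times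
eigenvector norms and products of the `b_i(0)`.

List the eigenvalues decreasingly for `t → +∞` and increasingly for `t → -∞`. The norms of the same
two eigenvectors enter the limits for `b_{n-k}(t)` and `b_k(-t)` in inverse ratios; they cancel in
the product, leaving only eigenvalue differences. -/

/-! ### Leading minors, triangular matrices and LR factorization -/

/-- The determinant of the leading `k × k` block of `M`. -/
noncomputable def leadingMinor {n : ℕ} (M : Matrix (Fin n) (Fin n) ℝ) (k : ℕ) (hk : k ≤ n) : ℝ :=
  (M.submatrix (Fin.castLE hk) (Fin.castLE hk)).det

/-- The hypothesis removes every path from the leading block to itself through an index at least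
`k`. -/
theorem submatrix_castLE_mul {n k : ℕ} (hk : k ≤ n) (A B : Matrix (Fin n) (Fin n) ℝ)
    (h : ∀ i j l : Fin n, (i : ℕ) < k → (j : ℕ) < k → k ≤ (l : ℕ) → A i l * B l j = 0) :
    (A * B).submatrix (Fin.castLE hk) (Fin.castLE hk) =
      A.submatrix (Fin.castLE hk) (Fin.castLE hk) *
        B.submatrix (Fin.castLE hk) (Fin.castLE hk) := by
  ext i j
  simp only [submatrix_apply, mul_apply]
  refine (Fintype.sum_of_injective (Fin.castLE hk) (Fin.castLE_injective hk) _ _ ?_ ?_).symm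
  · intro l hl
    refine h _ _ _ i.2 j.2 ?_
    by_contra hlt
    exact hl ⟨⟨l, not_le.1 hlt⟩, rfl⟩
  · intro l
    rfl

theorem leadingMinor_mul_of_upper {n k : ℕ} (hk : k ≤ n) (A B : Matrix (Fin n) (Fin n) ℝ)
    (hB : ∀ i j : Fin n, j < i → B i j = 0) :
    leadingMinor (A * B) k hk = leadingMinor A k hk * leadingMinor B k hk := by
  rw [leadingMinor, submatrix_castLE_mul hk, det_mul, leadingMinor, leadingMinor]
  intro i j l _ hj hl
  rw [hB l j (Fin.lt_def.2 (hj.trans_le hl)), mul_zero]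

theorem leadingMinor_mul_of_lower {n k : ℕ} (hk : k ≤ n) (A B : Matrix (Fin n) (Fin n) ℝ)
    (hA : ∀ i j : Fin n, i < j → A i j = 0) :
    leadingMinor (A * B) k hk = leadingMinor A k hk * leadingMinor B k hk := by
  rw [leadingMinor, submatrix_castLE_mul hk, det_mul, leadingMinor, leadingMinor]
  intro i j l hi _ hl
  rw [hA i l (Fin.lt_def.2 (hi.trans_le hl)), zero_mul]

theorem leadingMinor_of_upper {n k : ℕ} (hk : k ≤ n) (A : Matrix (Fin n) (Fin n) ℝ)
    (hA : ∀ i j : Fin n, j < i → A i j = 0) :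
    leadingMinor A k hk = ∏ i : Fin k, A (Fin.castLE hk i) (Fin.castLE hk i) :=
  det_of_isUpperTriangular fun _ _ hij => hA _ _ hij

theorem leadingMinor_of_lower {n k : ℕ} (hk : k ≤ n) (A : Matrix (Fin n) (Fin n) ℝ)
    (hA : ∀ i j : Fin n, i < j → A i j = 0) :
    leadingMinor A k hk = ∏ i : Fin k, A (Fin.castLE hk i) (Fin.castLE hk i) :=
  det_of_isLowerTriangular _ fun _ _ hij => hA _ _ hij

theorem leadingMinor_self {n : ℕ} (M : Matrix (Fin n) (Fin n) ℝ) :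
    leadingMinor M n le_rfl = M.det := rfl

theorem upper_inv {n : ℕ} {A : Matrix (Fin n) (Fin n) ℝ} (hA : ∀ i j : Fin n, j < i → A i j = 0)
    (hdet : IsUnit A.det) : ∀ i j : Fin n, j < i → A⁻¹ i j = 0 := by
  have := invertibleOfIsUnitDet A hdet
  have h : BlockTriangular A id := fun i j hij => hA i j hij
  exact fun i j hij => blockTriangular_inv_of_blockTriangular h hij

theorem lower_inv {n : ℕ} {A : Matrix (Fin n) (Fin n) ℝ} (hA : ∀ i j : Fin n, i < j → A i j = 0)
    (hdet : IsUnit A.det) : ∀ i j : Fin n, i < j → A⁻¹ i j = 0 := by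
  have := invertibleOfIsUnitDet A hdet
  have h : BlockTriangular A OrderDual.toDual := fun i j hij => hA i j hij
  exact fun i j hij => blockTriangular_inv_of_blockTriangular h hij

theorem lower_mul {n : ℕ} {A B : Matrix (Fin n) (Fin n) ℝ} (hA : ∀ i j : Fin n, i < j → A i j = 0)
    (hB : ∀ i j : Fin n, i < j → B i j = 0) : ∀ i j : Fin n, i < j → (A * B) i j = 0 := by
  have h : BlockTriangular A OrderDual.toDual := fun i j hij => hA i j hij
  have h' : BlockTriangular B OrderDual.toDual := fun i j hij => hB i j hij
  exact fun i j hij => h.mul h' hij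

theorem upper_mul {n : ℕ} {A B : Matrix (Fin n) (Fin n) ℝ} (hA : ∀ i j : Fin n, j < i → A i j = 0)
    (hB : ∀ i j : Fin n, j < i → B i j = 0) : ∀ i j : Fin n, j < i → (A * B) i j = 0 := by
  have h : BlockTriangular A id := fun i j hij => hA i j hij
  have h' : BlockTriangular B id := fun i j hij => hB i j hij
  exact fun i j hij => h.mul h' hij

theorem upper_mul_diag {n : ℕ} {A B : Matrix (Fin n) (Fin n) ℝ}
    (hA : ∀ i j : Fin n, j < i → A i j = 0) (hB : ∀ i j : Fin n, j < i → B i j = 0) (i : Fin n) :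
    (A * B) i i = A i i * B i i := by
  rw [mul_apply]
  refine Finset.sum_eq_single i (fun l _ hl => ?_) (by simp)
  rcases lt_or_gt_of_ne hl with h | h
  · rw [hA _ _ h, zero_mul]
  · rw [hB _ _ h, mul_zero]

theorem lower_mul_diag {n : ℕ} {A B : Matrix (Fin n) (Fin n) ℝ}
    (hA : ∀ i j : Fin n, i < j → A i j = 0) (hB : ∀ i j : Fin n, i < j → B i j = 0) (i : Fin n) :
    (A * B) i i = A i i * B i i := by
  rw [mul_apply]
  refine Finset.sum_eq_single i (fun l _ hl => ?_) (by simp)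
  rcases lt_or_gt_of_ne hl with h | h
  · rw [hB _ _ h, mul_zero]
  · rw [hA _ _ h, zero_mul]

theorem det_of_lower_unipotent {n : ℕ} {A : Matrix (Fin n) (Fin n) ℝ}
    (hA : ∀ i j : Fin n, i < j → A i j = 0) (h1 : ∀ i, A i i = 1) : A.det = 1 := by
  rw [det_of_isLowerTriangular A fun _ _ hij => hA _ _ hij]
  simp [h1]

theorem lower_unipotent_inv_diag {n : ℕ} {A : Matrix (Fin n) (Fin n) ℝ}
    (hA : ∀ i j : Fin n, i < j → A i j = 0) (h1 : ∀ i, A i i = 1) (i : Fin n) :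
    A⁻¹ i i = 1 := by
  have hu : IsUnit A.det := by rw [det_of_lower_unipotent hA h1]; exact isUnit_one
  have h := lower_mul_diag hA (lower_inv hA hu) i
  rw [mul_nonsing_inv A hu, one_apply_eq, h1, one_mul] at h
  exact h.symm

theorem IsLUFactorization.leadingMinor_eq {n : ℕ} {M L R : Matrix (Fin n) (Fin n) ℝ}
    (h : IsLUFactorization M L R) (k : ℕ) (hk : k ≤ n) :
    leadingMinor M k hk = ∏ i : Fin k, R (Fin.castLE hk i) (Fin.castLE hk i) := by
  rw [h.eq_mul, leadingMinor_mul_of_upper hk _ _ h.upper, leadingMinor_of_lower hk _ h.lower,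
    leadingMinor_of_upper hk _ h.upper]
  simp [h.unipotent]

theorem IsLUFactorization.leadingMinor_succ {n : ℕ} {M L R : Matrix (Fin n) (Fin n) ℝ}
    (h : IsLUFactorization M L R) (k : Fin n) :
    leadingMinor M (k + 1) k.2 = leadingMinor M k k.2.le * R k k := by
  rw [h.leadingMinor_eq, h.leadingMinor_eq, Fin.prod_univ_castSucc]
  rfl

/-- A matrix with non-vanishing leading minors has an `LR` factorization. -/
theorem exists_isLUFactorization {n : ℕ} (M : Matrix (Fin n) (Fin n) ℝ)
    (h : ∀ (k : ℕ) (hk : k ≤ n), leadingMinor M k hk ≠ 0) :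
    ∃ L R : Matrix (Fin n) (Fin n) ℝ, IsLUFactorization M L R := by
  -- Row `i` of `L⁻¹`: eliminating row `i` of `M` in the columns before `i` is a linear system with
  -- matrix the leading `i × i` block.
  have key : ∀ i : Fin n, ∃ c : Fin n → ℝ, (∀ j, i < j → c j = 0) ∧ c i = 1 ∧
      ∀ j, j < i → (c ᵥ* M) j = 0 := by
    intro i
    have hi : (i : ℕ) ≤ n := i.2.le
    set S := M.submatrix (Fin.castLE hi) (Fin.castLE hi) with hS
    have hSu : IsUnit S.det := (h i hi).isUnit
    let r : Fin i → ℝ := fun j => M i (Fin.castLE hi j)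
    let d : Fin i → ℝ := -(r ᵥ* S⁻¹)
    have hd : d ᵥ* S = -r := by
      simp only [d, neg_vecMul, vecMul_vecMul, nonsing_inv_mul S hSu, vecMul_one]
    refine ⟨fun j => if hj : (j : ℕ) < i then d ⟨j, hj⟩ else if j = i then 1 else 0, ?_, ?_, ?_⟩
    · intro j hj
      have h1 : ¬ (j : ℕ) < i := not_lt.2 (Fin.le_def.1 hj.le)
      simp [h1, hj.ne']
    · simp
    · intro j hj
      have hsum : ∀ l : Fin n, (if hj : (l : ℕ) < i then d ⟨l, hj⟩ else if l = i then 1 else 0)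
          * M l j = (if hj : (l : ℕ) < i then d ⟨l, hj⟩ else 0) * M l j +
            (if l = i then M l j else 0) := by
        intro l
        by_cases hl : (l : ℕ) < i
        · have : l ≠ i := fun h => by simp [h] at hl
          simp [hl, this]
        · simp [hl]
      simp only [vecMul, dotProduct, hsum, Finset.sum_add_distrib]
      rw [← Fintype.sum_of_injective (Fin.castLE hi) (Fin.castLE_injective hi)
        (fun l => d l * S l ⟨j, hj⟩)]
      · have := congrFun hd ⟨j, hj⟩
        simp only [vecMul, dotProduct] at this
        rw [this]
        simp [r]
      · intro l hl
        have : ¬ (l : ℕ) < i := fun hlt => hl ⟨⟨l, hlt⟩, rfl⟩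
        simp [this]
      · intro l
        simp [hS]
  choose c hc1 hc2 hc3 using key
  have hlow : ∀ i j : Fin n, i < j → (Matrix.of c) i j = 0 := hc1
  have hone : ∀ i : Fin n, (Matrix.of c) i i = 1 := hc2
  have hu : IsUnit (Matrix.of c).det := by
    rw [det_of_lower_unipotent hlow hone]; exact isUnit_one
  refine ⟨(Matrix.of c)⁻¹, Matrix.of c * M, lower_inv hlow hu,
    lower_unipotent_inv_diag hlow hone, fun i j hij => ?_, ?_⟩
  · exact hc3 i j hij
  · rw [nonsing_inv_mul_cancel_left _ _ hu]

/-! ### Powers of a diagonalizable matrix -/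

theorem diagonal_zpow {n : ℕ} {d : Fin n → ℝ} (hd : ∀ i, d i ≠ 0) (t : ℤ) :
    (diagonal d) ^ t = diagonal fun i => d i ^ t := by
  cases t with
  | ofNat m => simp [diagonal_pow, Pi.pow_def]
  | negSucc m =>
    rw [zpow_negSucc, diagonal_pow]
    refine inv_eq_right_inv ?_
    rw [diagonal_mul_diagonal, ← diagonal_one]
    congr 1
    funext i
    simp [_root_.zpow_negSucc, mul_inv_cancel₀ (pow_ne_zero (m + 1) (hd i))]

/-- Asymptotics of the leading minors of the powers of `X = P diag(d) P⁻¹`, along a filter for which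
the powers of the eigenvalues `d` are ordered decreasingly. -/
theorem tendsto_leadingMinor_zpow {n : ℕ} {X P : Matrix (Fin n) (Fin n) ℝ} {d : Fin n → ℝ}
    (hP : IsUnit P.det) (hd : ∀ i, d i ≠ 0) (hX : X * P = P * diagonal d)
    (hQ : ∀ (k : ℕ) (hk : k ≤ n), leadingMinor P⁻¹ k hk ≠ 0) {l : Filter ℤ}
    (hl : ∀ i j : Fin n, i < j → Tendsto (fun t : ℤ => (d j / d i) ^ t) l (𝓝 0))
    (k : ℕ) (hk : k ≤ n) :
    Tendsto (fun t : ℤ => leadingMinor (X ^ t) k hk / ∏ i : Fin k, d (Fin.castLE hk i) ^ t) l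
      (𝓝 (leadingMinor P k hk * leadingMinor P⁻¹ k hk)) := by
  obtain ⟨L, R, hLR⟩ := exists_isLUFactorization P⁻¹ hQ
  have hD : IsUnit (diagonal d).det := by
    rw [det_diagonal]; exact (Finset.prod_ne_zero_iff.2 fun i _ => hd i).isUnit
  have hXu : IsUnit X.det := by
    have h := congrArg det hX
    rw [det_mul, det_mul, mul_comm] at h
    rw [mul_left_cancel₀ hP.ne_zero h]
    exact hD
  let E : ℤ → Matrix (Fin n) (Fin n) ℝ := fun t => diagonal fun i => d i ^ t
  -- `C t` is `L` conjugated by the diagonal `E t`. Its entries below the diagonal decay, so `C t →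
  -- 1`, while the remaining factor `E t * R` is upper triangular and splits off from the minor.
  let C : ℤ → Matrix (Fin n) (Fin n) ℝ := fun t => Matrix.of fun i j => (d i / d j) ^ t * L i j
  have hpow : ∀ t : ℤ, X ^ t = P * C t * (E t * R) := by
    intro t
    have h : P * (diagonal d) ^ t = X ^ t * P :=
      Matrix.SemiconjBy.zpow_right hD hXu (show P * diagonal d = X * P from hX.symm) t
    have hC : C t * E t = E t * L := by
      ext i j
      simp only [C, E, mul_diagonal, diagonal_mul, of_apply, div_zpow]
      field_simp [zpow_ne_zero t (hd j)]
    calc X ^ t = X ^ t * P * P⁻¹ := (mul_nonsing_inv_cancel_right _ _ hP).symm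
      _ = P * (E t * L) * R := by
        rw [← h, diagonal_zpow hd, hLR.eq_mul]; simp only [E, Matrix.mul_assoc]
      _ = P * C t * (E t * R) := by rw [← hC]; simp only [Matrix.mul_assoc]
  have hdiag : ∀ t (i j : Fin n), j < i → E t i j = 0 := fun t i j hij =>
    diagonal_apply_ne' _ hij.ne
  have hminor : ∀ t : ℤ, leadingMinor (X ^ t) k hk / ∏ i : Fin k, d (Fin.castLE hk i) ^ t =
      leadingMinor (P * C t) k hk * leadingMinor P⁻¹ k hk := by
    intro t
    rw [hpow, leadingMinor_mul_of_upper hk _ _ (upper_mul (hdiag t) hLR.upper),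
      leadingMinor_mul_of_upper hk _ _ hLR.upper, leadingMinor_of_upper hk _ (hdiag t),
      leadingMinor_of_upper hk _ hLR.upper, ← hLR.leadingMinor_eq k hk]
    have h0 : ∏ i : Fin k, d (Fin.castLE hk i) ^ t ≠ 0 :=
      Finset.prod_ne_zero_iff.2 fun i _ => zpow_ne_zero t (hd _)
    simp only [E, diagonal_apply_eq]
    field_simp
  simp only [hminor]
  refine Tendsto.mul_const _ ?_
  have hC : Tendsto C l (𝓝 1) := by
    refine tendsto_pi_nhds.2 fun i => tendsto_pi_nhds.2 fun j => ?_
    simp only [C, of_apply]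
    rcases lt_trichotomy i j with h | h | h
    · simpa [hLR.lower i j h, one_apply_ne h.ne] using tendsto_const_nhds
    · subst h
      simpa [hLR.unipotent, hd] using tendsto_const_nhds
    · rw [one_apply_ne h.ne']
      simpa using (hl j i h).mul_const (L i j)
  have hcont : Continuous fun M : Matrix (Fin n) (Fin n) ℝ => leadingMinor (P * M) k hk := by
    unfold leadingMinor
    fun_prop
  have h1 := (hcont.tendsto 1).comp hC
  rwa [Matrix.mul_one] at h1

/-! ### Symes's dynamics and factorization of powers -/

/-- Factorizations accumulate: if `X₀ ^ t = M N` and `X t = M⁻¹ X₀ M = L R`, then `X₀ ^ (t + 1) = M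
(X t) N = (M L) (R N)`. A backward step uses `M L⁻¹` and `R⁻¹ N` instead. -/
theorem IsSymesOrbit.exists_isLUFactorization {n : ℕ} {X₀ : Matrix (Fin n) (Fin n) ℝ}
    {X : ℤ → Matrix (Fin n) (Fin n) ℝ} (h : IsSymesOrbit X₀ X) (h0 : IsUnit X₀.det) (t : ℤ) :
    ∃ L R : Matrix (Fin n) (Fin n) ℝ, IsLUFactorization (X₀ ^ t) L R ∧ X t = L⁻¹ * X₀ * L := by
  induction t using Int.induction_on with
  | zero =>
    refine ⟨1, 1, ⟨fun i j hij => one_apply_ne hij.ne, fun i => one_apply_eq i,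
      fun i j hij => one_apply_ne hij.ne', by simp⟩, by simp [h.initial]⟩
  | succ t ih =>
    obtain ⟨M, N, hMN, hX⟩ := ih
    obtain ⟨L, R, hLR, hZ⟩ := h.step t
    have hM : IsUnit M.det := by
      rw [det_of_lower_unipotent hMN.lower hMN.unipotent]; exact isUnit_one
    have hL : IsUnit L.det := by
      rw [det_of_lower_unipotent hLR.lower hLR.unipotent]; exact isUnit_one
    refine ⟨M * L, R * N, ⟨lower_mul hMN.lower hLR.lower, fun i => ?_,
      upper_mul hLR.upper hMN.upper, ?_⟩, ?_⟩
    · rw [lower_mul_diag hMN.lower hLR.lower, hMN.unipotent, hLR.unipotent, one_mul]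
    · have h1 : M * X t = X₀ * M := by
        rw [hX, Matrix.mul_assoc M⁻¹, mul_nonsing_inv_cancel_left _ _ hM]
      calc X₀ ^ ((t : ℤ) + 1) = X₀ * X₀ ^ (t : ℤ) := by rw [add_comm, zpow_one_add h0]
        _ = X₀ * M * N := by rw [hMN.eq_mul, Matrix.mul_assoc]
        _ = M * L * (R * N) := by rw [← h1, hLR.eq_mul]; simp only [Matrix.mul_assoc]
    · have h1 : L⁻¹ * X t = R := by rw [hLR.eq_mul, nonsing_inv_mul_cancel_left _ _ hL]
      rw [hZ, ← h1, hX, Matrix.mul_inv_rev]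
      simp only [Matrix.mul_assoc]
  | pred t ih =>
    obtain ⟨M, N, hMN, hX⟩ := ih
    obtain ⟨L, R, hLR, hZ⟩ := h.step (-(t : ℤ) - 1)
    rw [sub_add_cancel] at hZ
    have hM : IsUnit M.det := by
      rw [det_of_lower_unipotent hMN.lower hMN.unipotent]; exact isUnit_one
    have hL : IsUnit L.det := by
      rw [det_of_lower_unipotent hLR.lower hLR.unipotent]; exact isUnit_one
    have hXM : M * X (-(t : ℤ)) = X₀ * M := by
      rw [hX, Matrix.mul_assoc M⁻¹, mul_nonsing_inv_cancel_left _ _ hM]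
    have hR : IsUnit R.det := by
      have h1 := congrArg det hXM
      rw [hZ, det_mul, det_mul, det_mul, mul_comm X₀.det] at h1
      have h2 := mul_left_cancel₀ hM.ne_zero h1
      exact isUnit_of_mul_isUnit_left (h2 ▸ h0)
    have hLi := lower_inv hLR.lower hL
    refine ⟨M * L⁻¹, R⁻¹ * N, ⟨lower_mul hMN.lower hLi, fun i => ?_,
      upper_mul (upper_inv hLR.upper hR) hMN.upper, ?_⟩, ?_⟩
    · rw [lower_mul_diag hMN.lower hLi, hMN.unipotent,
        lower_unipotent_inv_diag hLR.lower hLR.unipotent, one_mul]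
    · have h3 : X₀ * (M * (L⁻¹ * R⁻¹)) = M := by
        rw [← Matrix.mul_assoc, ← hXM, hZ]
        simp only [Matrix.mul_assoc]
        rw [mul_nonsing_inv_cancel_left _ _ hL, mul_nonsing_inv _ hR, Matrix.mul_one]
      have h4 : X₀ * X₀ ^ (-(t : ℤ) - 1) = X₀ * (M * L⁻¹ * (R⁻¹ * N)) := by
        rw [← zpow_one_add h0, add_sub_cancel, hMN.eq_mul]
        conv_lhs => rw [← h3]
        simp only [Matrix.mul_assoc]
      rw [← nonsing_inv_mul_cancel_left X₀ (X₀ ^ (-(t : ℤ) - 1)) h0, h4,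
        nonsing_inv_mul_cancel_left _ _ h0]
    · rw [hLR.eq_mul, Matrix.mul_inv_rev, nonsing_inv_nonsing_inv _ hL]
      have h5 : M⁻¹ * X₀ * M = R * L := by rw [← hX, hZ]
      calc L * R = L * (R * L) * L⁻¹ := by
            rw [← Matrix.mul_assoc L R L, mul_nonsing_inv_cancel_right _ _ hL]
        _ = _ := by rw [← h5]; simp only [Matrix.mul_assoc]

/-- In `R X₀ R⁻¹` the outer factors are upper triangular and `X₀` vanishes below its subdiagonal, so
only diagonal entries of `R` reach the subdiagonal. -/
theorem conj_subdiag_mul {n : ℕ} {X₀ L R : Matrix (Fin n) (Fin n) ℝ}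
    (hX₀ : IsTridiagonalHessenberg X₀) (h0 : IsUnit X₀.det) {t : ℤ}
    (h : IsLUFactorization (X₀ ^ t) L R) {i j : Fin n} (hij : (i : ℕ) = j + 1) :
    (L⁻¹ * X₀ * L) i j * R j j = R i i * X₀ i j := by
  have hL : IsUnit L.det := by
    rw [det_of_lower_unipotent h.lower h.unipotent]; exact isUnit_one
  have hR : IsUnit R.det := by
    have h1 := h0.det_zpow t
    rw [h.eq_mul, det_mul] at h1
    exact isUnit_of_mul_isUnit_right h1
  have hRi := upper_inv h.upper hR
  have hconj : L⁻¹ * X₀ * L = R * X₀ * R⁻¹ := by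
    have h1 : X₀ * (L * R) = L * R * X₀ := by
      rw [← h.eq_mul]; exact (Matrix.Commute.self_zpow X₀ t)
    calc L⁻¹ * X₀ * L = L⁻¹ * (X₀ * (L * R)) * R⁻¹ := by
          simp only [Matrix.mul_assoc]
          rw [mul_nonsing_inv _ hR, Matrix.mul_one]
      _ = _ := by
          rw [h1]
          simp only [Matrix.mul_assoc]
          rw [nonsing_inv_mul_cancel_left _ _ hL]
  have hRX : ∀ l : Fin n, l ≤ j → (R * X₀) i l = if l = j then R i i * X₀ i j else 0 := by
    intro l hl
    rw [mul_apply, Finset.sum_eq_single i]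
    · split_ifs with hlj
      · rw [hlj]
      · rw [hX₀.below i l, mul_zero]
        have : (l : ℕ) < j := lt_of_le_of_ne hl fun h => hlj (Fin.ext h)
        omega
    · intro m _ hm
      rcases lt_or_gt_of_ne hm with hmi | hmi
      · rw [h.upper i m hmi, zero_mul]
      · rw [hX₀.below m l, mul_zero]
        have h1 : (i : ℕ) < m := hmi
        have h2 : (l : ℕ) ≤ j := hl
        omega
    · simp
  have hinv : R⁻¹ j j * R j j = 1 := by
    rw [← upper_mul_diag hRi h.upper, nonsing_inv_mul _ hR, one_apply_eq]
  rw [hconj, mul_apply, Finset.sum_eq_single j]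
  · rw [hRX j le_rfl, if_pos rfl, mul_assoc, hinv, mul_one]
  · intro l _ hl
    rcases lt_or_gt_of_ne hl with hlj | hlj
    · rw [hRX l hlj.le, if_neg hl, zero_mul]
    · rw [hRi l j hlj, mul_zero]
  · simp

/-! ### Eigenvectors from the three-term recurrence -/

/-- The monic polynomials defined by a three-term recurrence. -/
noncomputable def recurrencePoly (a b : ℕ → ℝ) : ℕ → Polynomial ℝ
  | 0 => 1
  | 1 => Polynomial.X - Polynomial.C (a 0)
  | m + 2 => (Polynomial.X - Polynomial.C (a (m + 1))) * recurrencePoly a b (m + 1) -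
      Polynomial.C (b (m + 1)) * recurrencePoly a b m

theorem recurrencePoly_monic_natDegree (a b : ℕ → ℝ) (m : ℕ) :
    (recurrencePoly a b m).Monic ∧ (recurrencePoly a b m).natDegree = m := by
  induction m using Nat.strong_induction_on with
  | _ m ih =>
    match m with
    | 0 => simp [recurrencePoly]
    | 1 => simpa [recurrencePoly] using Polynomial.monic_X_sub_C (a 0)
    | m + 2 =>
      obtain ⟨h1, h1'⟩ := ih (m + 1) (by omega)
      obtain ⟨h0, h0'⟩ := ih m (by omega)
      have hmon := (Polynomial.monic_X_sub_C (a (m + 1))).mul h1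
      have hdeg : ((Polynomial.X - Polynomial.C (a (m + 1))) *
          recurrencePoly a b (m + 1)).natDegree = m + 2 := by
        rw [(Polynomial.monic_X_sub_C (a (m + 1))).natDegree_mul h1, h1',
          Polynomial.natDegree_X_sub_C]
        ring
      have hlt : (Polynomial.C (b (m + 1)) * recurrencePoly a b m).natDegree <
          ((Polynomial.X - Polynomial.C (a (m + 1))) * recurrencePoly a b (m + 1)).natDegree := by
        rw [hdeg]
        refine (Polynomial.natDegree_C_mul_le _ _).trans_lt ?_
        omega
      rw [recurrencePoly]
      refine ⟨hmon.sub_of_left (Polynomial.degree_lt_degree hlt), ?_⟩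
      rw [Polynomial.natDegree_sub_eq_left_of_natDegree_lt hlt, hdeg]

/-- The `m`-th diagonal entry, counted from `0` and extended by `0`. -/
def diagEntry {n : ℕ} (X : Matrix (Fin n) (Fin n) ℝ) (m : ℕ) : ℝ :=
  if h : m < n then X ⟨m, h⟩ ⟨m, h⟩ else 0

/-- The monic polynomials giving the eigenvectors of a tridiagonal Hessenberg matrix. -/
noncomputable def hessenbergPoly {n : ℕ} (X : Matrix (Fin n) (Fin n) ℝ) : ℕ → Polynomial ℝ :=
  recurrencePoly (diagEntry X) (subdiagEntry X)

theorem mulVec_zero_of_tridiagonal {n : ℕ} {X : Matrix (Fin n) (Fin n) ℝ}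
    (hX : IsTridiagonalHessenberg X) (u : Fin n → ℝ) (h : 1 < n) :
    (X *ᵥ u) ⟨0, by omega⟩ = diagEntry X 0 * u ⟨0, by omega⟩ + u ⟨1, h⟩ := by
  have hne : (⟨0, by omega⟩ : Fin n) ≠ ⟨1, h⟩ := by simp
  rw [mulVec, dotProduct, ← Finset.sum_subset (Finset.subset_univ {⟨0, by omega⟩, ⟨1, h⟩}),
    Finset.sum_pair hne, hX.superdiag ⟨0, by omega⟩ ⟨1, h⟩ rfl, one_mul, diagEntry,
    dif_pos (by omega)]
  intro j _ hj
  simp only [Finset.mem_insert, Finset.mem_singleton, not_or, Fin.ext_iff] at hj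
  rw [hX.above _ _ (by simp only; omega), zero_mul]

theorem mulVec_succ_of_tridiagonal {n : ℕ} {X : Matrix (Fin n) (Fin n) ℝ}
    (hX : IsTridiagonalHessenberg X) (u : Fin n → ℝ) (m : ℕ) (h : m + 2 < n) :
    (X *ᵥ u) ⟨m + 1, by omega⟩ = subdiagEntry X (m + 1) * u ⟨m, by omega⟩ +
      (diagEntry X (m + 1) * u ⟨m + 1, by omega⟩ + u ⟨m + 2, h⟩) := by
  have hne : (⟨m + 1, by omega⟩ : Fin n) ≠ ⟨m + 2, h⟩ := by simp
  have hne' : (⟨m, by omega⟩ : Fin n) ∉ ({⟨m + 1, by omega⟩, ⟨m + 2, h⟩} : Finset (Fin n)) := by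
    simp
  rw [mulVec, dotProduct, ← Finset.sum_subset (Finset.subset_univ
      {⟨m, by omega⟩, ⟨m + 1, by omega⟩, ⟨m + 2, h⟩}), Finset.sum_insert hne',
    Finset.sum_pair hne, hX.superdiag ⟨m + 1, by omega⟩ ⟨m + 2, h⟩ rfl, one_mul, diagEntry,
    dif_pos (by omega), subdiagEntry, dif_pos (by omega)]
  · rfl
  intro j _ hj
  simp only [Finset.mem_insert, Finset.mem_singleton, not_or, Fin.ext_iff] at hj
  by_cases hjm : (j : ℕ) < m
  · rw [hX.below _ _ (by simp only; omega), zero_mul]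
  · rw [hX.above _ _ (by simp only; omega), zero_mul]

/-- Since the superdiagonal entries are 1, each row of the eigenvalue equation but the last gives
the next coordinate. -/
theorem eigenvector_eq_eval {n : ℕ} {X : Matrix (Fin n) (Fin n) ℝ}
    (hX : IsTridiagonalHessenberg X) {u : Fin n → ℝ} {x : ℝ} (hu : X *ᵥ u = x • u)
    (m : ℕ) (hm : m < n) :
    u ⟨m, hm⟩ = u ⟨0, by omega⟩ * (hessenbergPoly X m).eval x := by
  induction m using Nat.strong_induction_on with
  | _ m ih =>
    match m with
    | 0 => simp [hessenbergPoly, recurrencePoly]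
    | 1 =>
      have h := congrFun hu ⟨0, by omega⟩
      rw [mulVec_zero_of_tridiagonal hX u hm, Pi.smul_apply, smul_eq_mul] at h
      simp only [hessenbergPoly, recurrencePoly, Polynomial.eval_sub, Polynomial.eval_X,
        Polynomial.eval_C]
      linear_combination h
    | m + 2 =>
      have h := congrFun hu ⟨m + 1, by omega⟩
      have h1 := ih (m + 1) (by omega) (by omega)
      have h0 := ih m (by omega) (by omega)
      rw [mulVec_succ_of_tridiagonal hX u m hm, Pi.smul_apply, smul_eq_mul] at h
      simp only [hessenbergPoly] at h0 h1
      simp only [hessenbergPoly, recurrencePoly, Polynomial.eval_sub, Polynomial.eval_X,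
        Polynomial.eval_C, Polynomial.eval_mul]
      linear_combination h - subdiagEntry X (m + 1) * h0 + (x - diagEntry X (m + 1)) * h1

/-- The recurrence does not give the last row of the equation. It comes from rescaling an actual
eigenvector, whose first coordinate cannot vanish. -/
theorem mulVec_eval_of_mem_spectrum {n : ℕ} {X : Matrix (Fin n) (Fin n) ℝ}
    (hX : IsTridiagonalHessenberg X) {x : ℝ} (hx : x ∈ spectrum ℝ X) :
    (X *ᵥ fun i : Fin n => (hessenbergPoly X i).eval x) =
      x • fun i : Fin n => (hessenbergPoly X i).eval x := by
  have hdet : (algebraMap ℝ (Matrix (Fin n) (Fin n) ℝ) x - X).det = 0 := by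
    rw [spectrum.mem_iff, isUnit_iff_isUnit_det] at hx
    simpa using hx
  obtain ⟨u, hu0, hu⟩ := exists_mulVec_eq_zero_iff.2 hdet
  rw [sub_mulVec, Algebra.algebraMap_eq_smul_one, smul_mulVec, one_mulVec, sub_eq_zero] at hu
  obtain ⟨i, hi⟩ := Function.ne_iff.1 hu0
  have hn : 0 < n := i.pos
  have heq : u = u ⟨0, hn⟩ • fun i : Fin n => (hessenbergPoly X i).eval x := by
    funext j
    exact eigenvector_eq_eval hX hu.symm j j.2
  have hne : u ⟨0, hn⟩ ≠ 0 := by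
    intro h
    rw [heq, h] at hi
    simp at hi
  rw [heq, mulVec_smul, smul_comm] at hu
  exact (smul_right_injective _ hne hu).symm

/-! ### The eigenvector matrix and Vandermonde determinants -/

/-- The matrix whose columns are the eigenvectors for the eigenvalues `d`. -/
noncomputable def eigenMatrix {n : ℕ} (X : Matrix (Fin n) (Fin n) ℝ) (d : ℕ → ℝ) :
    Matrix (Fin n) (Fin n) ℝ :=
  Matrix.of fun i j => (hessenbergPoly X i).eval (d j)

/-- The Vandermonde determinant of `d 0, …, d (k - 1)`. -/
noncomputable def vandermondeDet (d : ℕ → ℝ) (k : ℕ) : ℝ :=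
  (vandermonde fun i : Fin k => d i).det

theorem vandermondeDet_succ (d : ℕ → ℝ) (k : ℕ) :
    vandermondeDet d (k + 1) = vandermondeDet d k * ∏ i ∈ Finset.range k, (d k - d i) := by
  -- Grouping the factors by their larger index makes the new node contribute exactly the last
  -- factor.
  have h : ∀ m, vandermondeDet d m =
      ∏ j ∈ Finset.range m, ∏ i ∈ Finset.range j, (d j - d i) := by
    intro m
    have h1 : ∀ i : Fin m, ∏ j ∈ Finset.Ioi i, (d j - d i) =
        ∏ j : Fin m, if i < j then d j - d i else 1 := by
      intro i
      rw [← Finset.prod_filter]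
      congr 1
      ext; simp
    rw [vandermondeDet, det_vandermonde, Finset.prod_congr rfl fun i _ => h1 i,
      Finset.prod_comm, Finset.prod_range]
    refine Finset.prod_congr rfl fun j _ => ?_
    rw [Finset.prod_range]
    refine (Fintype.prod_of_injective (Fin.castLE j.2.le) (Fin.castLE_injective _) _ _ ?_ ?_).symm
    · intro i hi
      rw [if_neg]
      intro hlt
      exact hi ⟨⟨i, hlt⟩, rfl⟩
    · intro i
      rw [if_pos (Fin.lt_def.2 (by simp))]
      rfl
  rw [h, h, Finset.prod_range_succ]

theorem vandermondeDet_ne_zero {d : ℕ → ℝ} {n : ℕ} (hd : Set.InjOn d (Set.Iio n)) {k : ℕ}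
    (hk : k ≤ n) : vandermondeDet d k ≠ 0 := by
  refine det_vandermonde_ne_zero_iff.2 fun i j hij => Fin.ext ?_
  exact hd (Set.mem_Iio.2 (i.2.trans_le hk)) (Set.mem_Iio.2 (j.2.trans_le hk)) hij

/-- Row `i` consists of values of a monic polynomial of degree `i`, so unipotent row operations lead
to the Vandermonde matrix. -/
theorem leadingMinor_eigenMatrix {n : ℕ} (X : Matrix (Fin n) (Fin n) ℝ) (d : ℕ → ℝ) (k : ℕ)
    (hk : k ≤ n) : leadingMinor (eigenMatrix X d) k hk = vandermondeDet d k := by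
  rw [vandermondeDet, det_eval_matrixOfPolynomials_eq_det_vandermonde _
    (fun i : Fin k => hessenbergPoly X i) (fun i => (recurrencePoly_monic_natDegree _ _ _).2)
    (fun i => (recurrencePoly_monic_natDegree _ _ _).1), leadingMinor, ← det_transpose]
  rfl

/-! ### Symmetrization and the inverse of the eigenvector matrix -/

/-- The product of the first `m` subdiagonal entries. -/
noncomputable def subdiagProd {n : ℕ} (X : Matrix (Fin n) (Fin n) ℝ) (m : ℕ) : ℝ :=
  ∏ i ∈ Finset.range m, subdiagEntry X (i + 1)

/-- The pairing of the right and the left eigenvector for the eigenvalue `x`. -/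
noncomputable def eigenNorm {n : ℕ} (X : Matrix (Fin n) (Fin n) ℝ) (x : ℝ) : ℝ :=
  ∑ i : Fin n, (hessenbergPoly X i).eval x ^ 2 * (subdiagProd X i)⁻¹

theorem subdiagProd_ne_zero {n : ℕ} {X : Matrix (Fin n) (Fin n) ℝ}
    (hb : ∀ i : ℕ, 1 ≤ i → i < n → subdiagEntry X i ≠ 0) {m : ℕ} (hm : m < n) :
    subdiagProd X m ≠ 0 := by
  refine Finset.prod_ne_zero_iff.2 fun i hi => hb _ (by omega) ?_
  have := Finset.mem_range.1 hi
  omega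

theorem transpose_mul_diagonal_subdiagProd {n : ℕ} {X : Matrix (Fin n) (Fin n) ℝ}
    (hX : IsTridiagonalHessenberg X)
    (hb : ∀ i : ℕ, 1 ≤ i → i < n → subdiagEntry X i ≠ 0) :
    Xᵀ * diagonal (fun i : Fin n => (subdiagProd X i)⁻¹) =
      diagonal (fun i : Fin n => (subdiagProd X i)⁻¹) * X := by
  have key : ∀ i j : Fin n, (j : ℕ) = i + 1 → X j i * (subdiagProd X j)⁻¹ =
      (subdiagProd X i)⁻¹ * X i j := by
    intro i j hij
    have hb' : X j i = subdiagEntry X j := by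
      rw [subdiagEntry, dif_pos ⟨by omega, j.2⟩]
      congr 1
      ext
      simp [hij]
    have h0 := hb j (by omega) j.2
    rw [hX.superdiag i j hij, hb', hij, subdiagProd, Finset.prod_range_succ, mul_inv, ← hij,
      mul_one, subdiagProd]
    field_simp
  ext i j
  rw [mul_diagonal, diagonal_mul, transpose_apply]
  rcases lt_trichotomy (i : ℕ) j with h | h | h
  · by_cases h1 : (j : ℕ) = i + 1
    · exact key i j h1
    · rw [hX.below j i (by omega), hX.above i j (by omega)]; simp
  · rw [Fin.ext h, mul_comm]
  · by_cases h1 : (i : ℕ) = j + 1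
    · linear_combination -key j i h1
    · rw [hX.above j i (by omega), hX.below i j (by omega)]; simp

section Spectral

variable {n : ℕ} {X : Matrix (Fin n) (Fin n) ℝ} {d : ℕ → ℝ}

theorem mul_eigenMatrix (hX : IsTridiagonalHessenberg X) (hs : ∀ i < n, d i ∈ spectrum ℝ X) :
    X * eigenMatrix X d = eigenMatrix X d * diagonal (fun i : Fin n => d i) := by
  ext i j
  have h := congrFun (mulVec_eval_of_mem_spectrum hX (hs j j.2)) i
  rw [mul_diagonal, mul_comm]
  exact h

theorem isUnit_det_eigenMatrix (hd : Set.InjOn d (Set.Iio n)) :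
    IsUnit (eigenMatrix X d).det := by
  rw [← leadingMinor_self, leadingMinor_eigenMatrix]
  exact (vandermondeDet_ne_zero hd le_rfl).isUnit

/-- Eigenvectors for distinct eigenvalues are orthogonal for the symmetrizing form: the Gram matrix
commutes with a diagonal matrix with distinct entries. -/
theorem eigenMatrix_gram (hX : IsTridiagonalHessenberg X)
    (hb : ∀ i : ℕ, 1 ≤ i → i < n → subdiagEntry X i ≠ 0)
    (hs : ∀ i < n, d i ∈ spectrum ℝ X) (hd : Set.InjOn d (Set.Iio n)) :
    (eigenMatrix X d)ᵀ * diagonal (fun i : Fin n => (subdiagProd X i)⁻¹) * eigenMatrix X d =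
      diagonal fun i : Fin n => eigenNorm X (d i) := by
  set P := eigenMatrix X d with hP
  set D := diagonal (fun i : Fin n => (subdiagProd X i)⁻¹) with hD
  have hXP : X * P = P * diagonal (fun i : Fin n => d i) := mul_eigenMatrix hX hs
  have hcomm : diagonal (fun i : Fin n => d i) * (Pᵀ * D * P) =
      Pᵀ * D * P * diagonal (fun i : Fin n => d i) := by
    have h1 : diagonal (fun i : Fin n => d i) * Pᵀ = Pᵀ * Xᵀ := by
      rw [← transpose_mul, hXP, transpose_mul, diagonal_transpose]
    rw [Matrix.mul_assoc (Pᵀ * D), ← hXP, ← Matrix.mul_assoc, ← Matrix.mul_assoc, h1,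
      Matrix.mul_assoc Pᵀ, transpose_mul_diagonal_subdiagProd hX hb]
    simp only [Matrix.mul_assoc, hD]
  ext i j
  by_cases hij : i = j
  · subst hij
    rw [diagonal_apply_eq, mul_apply, eigenNorm]
    refine Finset.sum_congr rfl fun l _ => ?_
    simp only [hD, mul_diagonal, transpose_apply, hP, eigenMatrix, of_apply]
    ring
  · rw [diagonal_apply_ne _ hij]
    have h := congrFun (congrFun hcomm i) j
    rw [diagonal_mul, mul_diagonal, mul_comm, ← sub_eq_zero, ← mul_sub] at h
    refine (mul_eq_zero.1 h).resolve_right fun h0 => hij (Fin.ext ?_)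
    exact hd i.2 j.2 (sub_eq_zero.1 h0)

/-- The `b_i(0)` may be negative, so the form may be indefinite and positivity is unavailable; the
Gram determinant is nonzero instead. -/
theorem eigenNorm_ne_zero (hX : IsTridiagonalHessenberg X)
    (hb : ∀ i : ℕ, 1 ≤ i → i < n → subdiagEntry X i ≠ 0)
    (hs : ∀ i < n, d i ∈ spectrum ℝ X) (hd : Set.InjOn d (Set.Iio n)) {i : ℕ} (hi : i < n) :
    eigenNorm X (d i) ≠ 0 := by
  have h := congrArg det (eigenMatrix_gram hX hb hs hd)
  rw [det_mul, det_mul, det_transpose, det_diagonal, det_diagonal] at h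
  have hP := (isUnit_det_eigenMatrix (X := X) hd).ne_zero
  have hB : ∏ i : Fin n, (subdiagProd X i)⁻¹ ≠ 0 :=
    Finset.prod_ne_zero_iff.2 fun i _ => inv_ne_zero (subdiagProd_ne_zero hb i.2)
  have hN := h ▸ mul_ne_zero (mul_ne_zero hP hB) hP
  exact Finset.prod_ne_zero_iff.1 hN ⟨i, hi⟩ (Finset.mem_univ _)

theorem eigenMatrix_inv (hX : IsTridiagonalHessenberg X)
    (hb : ∀ i : ℕ, 1 ≤ i → i < n → subdiagEntry X i ≠ 0)
    (hs : ∀ i < n, d i ∈ spectrum ℝ X) (hd : Set.InjOn d (Set.Iio n)) :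
    (eigenMatrix X d)⁻¹ = diagonal (fun i : Fin n => (eigenNorm X (d i))⁻¹) *
      ((eigenMatrix X d)ᵀ * diagonal (fun i : Fin n => (subdiagProd X i)⁻¹)) := by
  refine inv_eq_left_inv ?_
  rw [Matrix.mul_assoc, eigenMatrix_gram hX hb hs hd, diagonal_mul_diagonal, ← diagonal_one]
  congr 1
  funext i
  exact inv_mul_cancel₀ (eigenNorm_ne_zero hX hb hs hd i.2)

theorem leadingMinor_eigenMatrix_inv (hX : IsTridiagonalHessenberg X)
    (hb : ∀ i : ℕ, 1 ≤ i → i < n → subdiagEntry X i ≠ 0)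
    (hs : ∀ i < n, d i ∈ spectrum ℝ X) (hd : Set.InjOn d (Set.Iio n)) (k : ℕ) (hk : k ≤ n) :
    leadingMinor (eigenMatrix X d)⁻¹ k hk = (∏ i ∈ Finset.range k, (eigenNorm X (d i))⁻¹) *
      (vandermondeDet d k * ∏ i ∈ Finset.range k, (subdiagProd X i)⁻¹) := by
  have hdiag : ∀ (f : Fin n → ℝ) (i j : Fin n), i ≠ j → diagonal f i j = 0 :=
    fun f i j hij => diagonal_apply_ne _ hij
  rw [eigenMatrix_inv hX hb hs hd,
    leadingMinor_mul_of_lower hk _ _ (fun i j hij => hdiag _ i j hij.ne),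
    leadingMinor_mul_of_upper hk _ _ (fun i j hij => hdiag _ i j hij.ne'),
    leadingMinor_of_lower hk _ (fun i j hij => hdiag _ i j hij.ne),
    leadingMinor_of_lower hk _ (fun i j hij => hdiag _ i j hij.ne),
    ← leadingMinor_eigenMatrix X d k hk, Finset.prod_range, Finset.prod_range]
  simp only [diagonal_apply_eq, Fin.val_castLE]
  rw [leadingMinor, leadingMinor, ← transpose_submatrix, det_transpose]

end Spectral

/-! ### Asymptotics of minors and subdiagonal entries -/

section Asymptotics

variable {n : ℕ} {X : Matrix (Fin n) (Fin n) ℝ} {d : ℕ → ℝ} {l : Filter ℤ}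

theorem eventually_leadingMinor_ne_zero_and_tendsto_ratio (hX : IsTridiagonalHessenberg X)
    (hb : ∀ i : ℕ, 1 ≤ i → i < n → subdiagEntry X i ≠ 0)
    (hs : ∀ i < n, d i ∈ spectrum ℝ X) (hd : Set.InjOn d (Set.Iio n)) (hd0 : ∀ i < n, d i ≠ 0)
    (hl : ∀ i j : ℕ, i < j → j < n → Tendsto (fun t : ℤ => (d j / d i) ^ t) l (𝓝 0)) :
    (∀ (k : ℕ) (hk : k ≤ n), ∀ᶠ t in l, leadingMinor (X ^ t) k hk ≠ 0) ∧
    ∀ (k : ℕ) (hk : k < n),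
      Tendsto (fun t : ℤ => leadingMinor (X ^ t) (k + 1) hk / leadingMinor (X ^ t) k hk.le /
        d k ^ t) l (𝓝 ((∏ i ∈ Finset.range k, (d k - d i)) ^ 2 *
          ((eigenNorm X (d k))⁻¹ * (subdiagProd X k)⁻¹))) := by
  -- The limit constant: `k`-th minor of `P` times `k`-th minor of `P⁻¹`.
  set c : ℕ → ℝ := fun k => vandermondeDet d k *
    ((∏ i ∈ Finset.range k, (eigenNorm X (d i))⁻¹) *
      (vandermondeDet d k * ∏ i ∈ Finset.range k, (subdiagProd X i)⁻¹)) with hc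
  have hQ0 : ∀ k ≤ n, (∏ i ∈ Finset.range k, (eigenNorm X (d i))⁻¹) *
      (vandermondeDet d k * ∏ i ∈ Finset.range k, (subdiagProd X i)⁻¹) ≠ 0 := by
    intro k hk
    refine mul_ne_zero (Finset.prod_ne_zero_iff.2 fun i hi => ?_)
      (mul_ne_zero (vandermondeDet_ne_zero hd hk) (Finset.prod_ne_zero_iff.2 fun i hi => ?_))
    · exact inv_ne_zero (eigenNorm_ne_zero hX hb hs hd ((Finset.mem_range.1 hi).trans_le hk))
    · exact inv_ne_zero (subdiagProd_ne_zero hb ((Finset.mem_range.1 hi).trans_le hk))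
  have hc0 : ∀ k ≤ n, c k ≠ 0 := fun k hk =>
    mul_ne_zero (vandermondeDet_ne_zero hd hk) (hQ0 k hk)
  have hlim : ∀ (k : ℕ) (hk : k ≤ n),
      Tendsto (fun t : ℤ => leadingMinor (X ^ t) k hk / ∏ i ∈ Finset.range k, d i ^ t) l
        (𝓝 (c k)) := by
    intro k hk
    have h := tendsto_leadingMinor_zpow (isUnit_det_eigenMatrix (X := X) hd)
      (fun i : Fin n => hd0 i i.2) (mul_eigenMatrix hX hs)
      (fun k hk => by rw [leadingMinor_eigenMatrix_inv hX hb hs hd]; exact hQ0 k hk)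
      (fun i j hij => hl i j hij j.2) k hk
    rw [leadingMinor_eigenMatrix_inv hX hb hs hd, leadingMinor_eigenMatrix] at h
    simpa only [hc, Finset.prod_range, Fin.val_castLE] using h
  refine ⟨fun k hk => ?_, fun k hk => ?_⟩
  · filter_upwards [(hlim k hk).eventually_ne (hc0 k hk)] with t ht h0
    simp [h0] at ht
  · have h := (hlim (k + 1) hk).div (hlim k hk.le) (hc0 k hk.le)
    have hval : c (k + 1) / c k = (∏ i ∈ Finset.range k, (d k - d i)) ^ 2 *
        ((eigenNorm X (d k))⁻¹ * (subdiagProd X k)⁻¹) := by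
      rw [div_eq_iff (hc0 k hk.le)]
      simp only [hc, vandermondeDet_succ, Finset.prod_range_succ]
      ring
    rw [hval] at h
    refine h.congr fun t => ?_
    have h1 : ∏ i ∈ Finset.range k, d i ^ t ≠ 0 := Finset.prod_ne_zero_iff.2 fun i hi =>
      zpow_ne_zero t (hd0 i ((Finset.mem_range.1 hi).trans hk))
    rw [Pi.div_apply, Finset.prod_range_succ, mul_comm, ← div_div,
      div_div_div_cancel_right₀ h1, div_right_comm]

theorem eventually_exists_isLUFactorization (hX : IsTridiagonalHessenberg X)
    (hb : ∀ i : ℕ, 1 ≤ i → i < n → subdiagEntry X i ≠ 0)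
    (hs : ∀ i < n, d i ∈ spectrum ℝ X) (hd : Set.InjOn d (Set.Iio n)) (hd0 : ∀ i < n, d i ≠ 0)
    (hl : ∀ i j : ℕ, i < j → j < n → Tendsto (fun t : ℤ => (d j / d i) ^ t) l (𝓝 0)) :
    ∀ᶠ t in l, ∃ L R : Matrix (Fin n) (Fin n) ℝ, IsLUFactorization (X ^ t) L R := by
  have h := (eventually_leadingMinor_ne_zero_and_tendsto_ratio hX hb hs hd hd0 hl).1
  have h' : ∀ᶠ t in l, ∀ k : Fin (n + 1), leadingMinor (X ^ t) k k.is_le ≠ 0 :=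
    eventually_all.2 fun k => h k k.is_le
  filter_upwards [h'] with t ht
  exact exists_isLUFactorization _ fun k hk => ht ⟨k, Nat.lt_succ_of_le hk⟩

theorem tendsto_subdiagEntry (hX : IsTridiagonalHessenberg X)
    (hb : ∀ i : ℕ, 1 ≤ i → i < n → subdiagEntry X i ≠ 0) (h0 : IsUnit X.det)
    (hs : ∀ i < n, d i ∈ spectrum ℝ X) (hd : Set.InjOn d (Set.Iio n)) (hd0 : ∀ i < n, d i ≠ 0)
    (hl : ∀ i j : ℕ, i < j → j < n → Tendsto (fun t : ℤ => (d j / d i) ^ t) l (𝓝 0))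
    {Y : ℤ → Matrix (Fin n) (Fin n) ℝ}
    (hY : ∀ᶠ t in l, ∃ L R : Matrix (Fin n) (Fin n) ℝ,
      IsLUFactorization (X ^ t) L R ∧ Y t = L⁻¹ * X * L) {j : ℕ} (hj : j + 1 < n) :
    Tendsto (fun t : ℤ => subdiagEntry (Y t) (j + 1) * (d j / d (j + 1)) ^ t) l
      (𝓝 (eigenNorm X (d j) / eigenNorm X (d (j + 1)) *
        ((∏ i ∈ Finset.range (j + 1), (d (j + 1) - d i) ^ 2) /
          ∏ i ∈ Finset.range j, (d j - d i) ^ 2))) := by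
  obtain ⟨hne, hrat⟩ := eventually_leadingMinor_ne_zero_and_tendsto_ratio hX hb hs hd hd0 hl
  have hjn : j < n := by omega
  have hN := eigenNorm_ne_zero hX hb hs hd hjn
  have hN' := eigenNorm_ne_zero hX hb hs hd hj
  have hB := subdiagProd_ne_zero hb hjn
  have hbj := hb (j + 1) (by omega) hj
  have hprod : ∏ i ∈ Finset.range j, (d j - d i) ≠ 0 := by
    refine Finset.prod_ne_zero_iff.2 fun i hi => sub_ne_zero.2 fun h => ?_
    have hij := Finset.mem_range.1 hi
    exact hij.ne' (hd hjn (hij.trans hjn) h)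
  have hlim := ((hrat (j + 1) hj).div (hrat j hjn) (mul_ne_zero (pow_ne_zero 2 hprod)
    (mul_ne_zero (inv_ne_zero hN) (inv_ne_zero hB)))).const_mul (subdiagEntry X (j + 1))
  -- The initial entry cancels against the quotient of consecutive `subdiagProd`s.
  have hval : subdiagEntry X (j + 1) * ((∏ i ∈ Finset.range (j + 1), (d (j + 1) - d i)) ^ 2 *
      ((eigenNorm X (d (j + 1)))⁻¹ * (subdiagProd X (j + 1))⁻¹) /
      ((∏ i ∈ Finset.range j, (d j - d i)) ^ 2 *
        ((eigenNorm X (d j))⁻¹ * (subdiagProd X j)⁻¹))) =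
      eigenNorm X (d j) / eigenNorm X (d (j + 1)) *
        ((∏ i ∈ Finset.range (j + 1), (d (j + 1) - d i) ^ 2) /
          ∏ i ∈ Finset.range j, (d j - d i) ^ 2) := by
    rw [Finset.prod_pow, Finset.prod_pow]
    have hB' : subdiagProd X (j + 1) = subdiagProd X j * subdiagEntry X (j + 1) :=
      Finset.prod_range_succ _ _
    rw [hB']
    field_simp
  rw [hval] at hlim
  refine hlim.congr' ?_
  filter_upwards [hY, hne j hjn.le, hne (j + 1) hjn, hne (j + 2) hj] with t ht h1 h2 h3
  obtain ⟨L, R, hLR, hYt⟩ := ht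
  have e1 := hLR.leadingMinor_succ ⟨j, hjn⟩
  have e2 := hLR.leadingMinor_succ ⟨j + 1, hj⟩
  simp only at e1 e2
  have e3 := conj_subdiag_mul hX h0 hLR (i := ⟨j + 1, hj⟩) (j := ⟨j, hjn⟩) rfl
  have hR : R ⟨j, hjn⟩ ⟨j, hjn⟩ ≠ 0 := fun h => h2 (by rw [e1, h, mul_zero])
  have hbX : ∀ Z : Matrix (Fin n) (Fin n) ℝ,
      subdiagEntry Z (j + 1) = Z ⟨j + 1, hj⟩ ⟨j, hjn⟩ := fun Z => dif_pos ⟨by omega, hj⟩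
  have hd1 := zpow_ne_zero t (hd0 j hjn)
  have hd2 := zpow_ne_zero t (hd0 (j + 1) hj)
  rw [← hYt] at e3
  rw [Pi.div_apply, hbX, hbX, e2, mul_div_cancel_left₀ _ h2, e1, mul_div_cancel_left₀ _ h1,
    div_zpow]
  field_simp
  linear_combination -e3

end Asymptotics

/-! ### The two time directions combined -/

theorem tendsto_zpow_atTop_nhds_zero {r : ℝ} (h0 : 0 ≤ r) (h1 : r < 1) :
    Tendsto (fun t : ℤ => r ^ t) atTop (𝓝 0) := by
  have h := (tendsto_pow_atTop_nhds_zero_of_lt_one h0 h1).comp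
    (tendsto_atTop_mono Int.self_le_toNat tendsto_id |> tendsto_natCast_atTop_iff.1)
  refine h.congr' ?_
  filter_upwards [eventually_ge_atTop 0] with t ht
  rw [Function.comp_apply, ← zpow_natCast, Int.toNat_of_nonneg ht]

theorem isUnit_det_of_eigenvalues {n : ℕ} {X : Matrix (Fin n) (Fin n) ℝ}
    (h : (0 : ℝ) ∉ spectrum ℝ X) : IsUnit X.det := by
  rwa [← isUnit_iff_isUnit_det, ← spectrum.zero_notMem_iff ℝ]

/-- Here `p` and `q` stand for the two eigenvector norms. The products are matched by `j = i + 1`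
for the increasing listing of eigenvalues and `j = n - i` for the decreasing one. -/
theorem phaseShiftLimit_value {n k : ℕ} (lam : ℕ → ℝ) (hk : 1 ≤ k) (hkn : k < n) {p q : ℝ}
    (hp : p ≠ 0) (hq : q ≠ 0) :
    p / q * ((∏ i ∈ Finset.range (n - k), (lam (n - k + 1) - lam (i + 1)) ^ 2) /
        ∏ i ∈ Finset.range (n - k - 1), (lam (n - k) - lam (i + 1)) ^ 2) *
      (q / p * ((∏ i ∈ Finset.range k, (lam (n - k) - lam (n - i)) ^ 2) /
        ∏ i ∈ Finset.range (k - 1), (lam (n - k + 1) - lam (n - i)) ^ 2)) =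
    ((∏ j ∈ Finset.Ico 1 (k + 1), (lam (n - k) - lam (n - j + 1)) ^ 2) *
          ∏ j ∈ Finset.Ioc k n, (lam (n - k + 1) - lam (n - j + 1)) ^ 2) /
        ((∏ j ∈ Finset.Ioc (k + 1) n, (lam (n - k) - lam (n - j + 1)) ^ 2) *
          ∏ j ∈ Finset.Ico 1 k, (lam (n - k + 1) - lam (n - j + 1)) ^ 2) := by
  have hlow : ∀ (m : ℕ) (x : ℝ), 1 ≤ m → m ≤ n →
      ∏ i ∈ Finset.range (m - 1), (x - lam (n - i)) ^ 2 =
        ∏ j ∈ Finset.Ico 1 m, (x - lam (n - j + 1)) ^ 2 := by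
    intro m x hm hmn
    rw [Finset.prod_Ico_eq_prod_range]
    refine Finset.prod_congr rfl fun i hi => ?_
    have := Finset.mem_range.1 hi
    congr 3
    omega
  have hhigh : ∀ (m : ℕ) (x : ℝ), m ≤ n →
      ∏ i ∈ Finset.range (n - m), (x - lam (i + 1)) ^ 2 =
        ∏ j ∈ Finset.Ioc m n, (x - lam (n - j + 1)) ^ 2 := by
    intro m x hm
    refine Finset.prod_bij' (fun i _ => n - i) (fun j _ => n - j) ?_ ?_ ?_ ?_ ?_
    all_goals intro i hi; simp only [Finset.mem_range, Finset.mem_Ioc] at hi ⊢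
    · omega
    · omega
    · omega
    · omega
    · congr 3
      omega
  rw [← hlow (k + 1) _ (by omega) hkn, ← hlow k _ hk hkn.le, ← hhigh k _ hkn.le,
    ← hhigh (k + 1) _ hkn, Nat.add_sub_cancel, Nat.sub_sub]
  field_simp

theorem mainTheorem3 (n : ℕ) (lam : ℕ → ℝ)
    (hlam : StrictAntiOn lam (Set.Icc 1 n)) (hpos : ∀ i ∈ Set.Icc 1 n, 0 < lam i)
    (X₀ : Matrix (Fin n) (Fin n) ℝ) (hX₀ : IsTridiagonalHessenberg X₀)
    (hb : ∀ i : ℕ, 1 ≤ i → i < n → subdiagEntry X₀ i ≠ 0)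
    (hspec : spectrum ℝ X₀ = lam '' Set.Icc 1 n)
    (k : ℕ) (hk : 1 ≤ k) (hkn : k < n) :
    (∀ X : ℤ → Matrix (Fin n) (Fin n) ℝ, IsSymesOrbit X₀ X → PhaseShiftLimit n lam X k) ∧
    (∃ T : ℤ, ∀ t : ℤ, T ≤ |t| →
      ∃ L R : Matrix (Fin n) (Fin n) ℝ, IsLUFactorization (X₀ ^ t) L R) ∧
    (∀ X : ℤ → Matrix (Fin n) (Fin n) ℝ, IsContinuedOrbit X₀ X → PhaseShiftLimit n lam X k) := by
  have h0 : IsUnit X₀.det := by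
    refine isUnit_det_of_eigenvalues fun h => ?_
    rw [hspec] at h
    obtain ⟨i, hi, hi0⟩ := h
    exact (hpos i hi).ne' hi0
  have mem₁ : ∀ i < n, i + 1 ∈ Set.Icc 1 n := fun i hi => ⟨by omega, hi⟩
  have mem₂ : ∀ i < n, n - i ∈ Set.Icc 1 n := fun i hi => ⟨by omega, by omega⟩
  have hs₁ : ∀ i < n, lam (i + 1) ∈ spectrum ℝ X₀ := fun i hi => by
    rw [hspec]; exact ⟨_, mem₁ i hi, rfl⟩
  have hs₂ : ∀ i < n, lam (n - i) ∈ spectrum ℝ X₀ := fun i hi => by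
    rw [hspec]; exact ⟨_, mem₂ i hi, rfl⟩
  have hd₁ : Set.InjOn (fun i => lam (i + 1)) (Set.Iio n) := fun i hi j hj h => by
    have := hlam.injOn (mem₁ i hi) (mem₁ j hj) h
    omega
  have hd₂ : Set.InjOn (fun i => lam (n - i)) (Set.Iio n) := fun i hi j hj h => by
    have := hlam.injOn (mem₂ i hi) (mem₂ j hj) h
    have h1 : i < n := hi
    have h2 : j < n := hj
    omega
  have hz₁ : ∀ i < n, lam (i + 1) ≠ 0 := fun i hi => (hpos _ (mem₁ i hi)).ne'
  have hz₂ : ∀ i < n, lam (n - i) ≠ 0 := fun i hi => (hpos _ (mem₂ i hi)).ne'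
  have hl₁ : ∀ i j : ℕ, i < j → j < n →
      Tendsto (fun t : ℤ => (lam (j + 1) / lam (i + 1)) ^ t) atTop (𝓝 0) := by
    intro i j hij hj
    have hi := hpos _ (mem₁ i (hij.trans hj))
    refine tendsto_zpow_atTop_nhds_zero (div_nonneg (hpos _ (mem₁ j hj)).le hi.le) ?_
    rw [div_lt_one hi]
    exact hlam (mem₁ i (hij.trans hj)) (mem₁ j hj) (by omega)
  have hl₂ : ∀ i j : ℕ, i < j → j < n →
      Tendsto (fun t : ℤ => (lam (n - j) / lam (n - i)) ^ t) atBot (𝓝 0) := by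
    intro i j hij hj
    have hj' := hpos _ (mem₂ j hj)
    have h := (tendsto_zpow_atTop_nhds_zero
      (div_nonneg (hpos _ (mem₂ i (hij.trans hj))).le hj'.le) ((div_lt_one hj').2
        (hlam (mem₂ j hj) (mem₂ i (hij.trans hj)) (by omega)))).comp tendsto_neg_atBot_atTop
    refine h.congr fun t => ?_
    rw [Function.comp_apply, _root_.zpow_neg, ← _root_.inv_zpow, inv_div]
  have hLU₁ := eventually_exists_isLUFactorization hX₀ hb hs₁ hd₁ hz₁ hl₁
  have hLU₂ := eventually_exists_isLUFactorization hX₀ hb hs₂ hd₂ hz₂ hl₂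
  have main : ∀ X : ℤ → Matrix (Fin n) (Fin n) ℝ,
      (∀ t, (∃ L R : Matrix (Fin n) (Fin n) ℝ, IsLUFactorization (X₀ ^ t) L R) →
        ∃ L R : Matrix (Fin n) (Fin n) ℝ, IsLUFactorization (X₀ ^ t) L R ∧
          X t = L⁻¹ * X₀ * L) → PhaseShiftLimit n lam X k := by
    intro X hX
    have T₁ := tendsto_subdiagEntry hX₀ hb h0 hs₁ hd₁ hz₁ hl₁ (hLU₁.mono hX)
      (j := n - k - 1) (by omega)
    have T₂ := (tendsto_subdiagEntry hX₀ hb h0 hs₂ hd₂ hz₂ hl₂ (hLU₂.mono hX)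
      (j := k - 1) (by omega)).comp tendsto_neg_atTop_atBot
    have e1 : n - k - 1 + 1 = n - k := by omega
    have e2 : k - 1 + 1 = k := by omega
    have e3 : n - (k - 1) = n - k + 1 := by omega
    simp only [e1, e2, e3] at T₁ T₂
    have T := T₁.mul T₂
    have hN : ∀ i ∈ Set.Icc 1 n, eigenNorm X₀ (lam i) ≠ 0 := by
      intro i hi
      have h := eigenNorm_ne_zero hX₀ hb hs₁ hd₁ (i := i - 1) (by have := hi.1; have := hi.2; omega)
      simpa only [Nat.sub_add_cancel hi.1] using h
    rw [phaseShiftLimit_value lam hk hkn (hN _ ⟨by omega, by omega⟩) (hN _ ⟨by omega, by omega⟩)]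
      at T
    refine T.congr fun t => ?_
    have hr : lam (n - k) / lam (n - k + 1) ≠ 0 :=
      div_ne_zero (hpos _ ⟨by omega, by omega⟩).ne' (hpos _ ⟨by omega, by omega⟩).ne'
    rw [Function.comp_apply, _root_.zpow_neg (lam (n - k + 1) / lam (n - k)), ← _root_.inv_zpow, inv_div,
      two_mul, zpow_add₀ hr]
    ring
  refine ⟨fun X hX => main X fun t _ => hX.exists_isLUFactorization h0 t, ?_,
    fun X hX => main X fun t ⟨L, R, h⟩ => ⟨L, R, h, hX t L R h⟩⟩
  obtain ⟨a, ha⟩ := eventually_atTop.1 hLU₁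
  obtain ⟨b, hb'⟩ := eventually_atBot.1 hLU₂
  refine ⟨max a (-b), fun t ht => ?_⟩
  rcases le_total 0 t with h | h
  · rw [abs_of_nonneg h] at ht
    exact ha t ((le_max_left _ _).trans ht)
  · rw [abs_of_nonpos h] at ht
    have := (le_max_right a (-b)).trans ht
    exact hb' t (by omega)
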